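/- **Setting.** Let $(\mathcal V,\otimes,*_{\mathcal V})$ and $(\mathcal U,\otimes,*_{\mathcal U})$ be locally small symmetric monoidal closed categories, each of which is locally finitely presentable (in particular complete and cocomplete) and regular, and in each of which the tensor product of finitely presentable objects is finitely presentable. Let $G:\mathcal V\to\mathcal U$ be a lax monoidal functor with a left adjoint $F:\mathcal U\to\mathcal V$ such that $F\dashv G$ is an adjunction in the 2-category of monoidal categories, lax monoidal functors and monoidal natural transformations. Let $\mathcal C$ be a (small) $\mathcal V$-category, and let $G_*\mathcal C$ be the $\mathcal U$-category with the same objects, hom-objects $G(\mathcal C(x,y))$, and identities and composition induced from those of $\mathcal C$ by the lax structure of $G$. Fix a generating set $\mathcal G_{\mathcal U}$ of finitely presentable objects of $\mathcal U$, and a family $\mathcal G_{\mathcal V}$ of objects of $\mathcal V$ that contains $Fg$ for every $g\in\mathcal G_{\mathcal U}$ (for instance $\mathcal G_{\mathcal V}=\{Fg: g\in\mathcal G_{\mathcal U}\}$). **Coverages.** Let $\mathcal W$ be $\mathcal V$ or $\mathcal U$, and $\mathcal X$ a $\mathcal W$-category. A *sieve* on $x\in\mathcal X$ is a subobject of $\mathcal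 X(-,x)$, i.e. an isomorphism class of $\mathcal W$-natural transformations $r:R\to\mathcal X(-,x)$ of $\mathcal W$-functors $\mathcal X^{\mathrm{op}}\to\mathcal W$ all of whose components are monomorphisms. For $v\in\mathcal W$ and $f:v\to\mathcal X(y,x)$, the sieve $R_f$ on $y$ is the pointwise pullback of $\{v,r\}:\{v,R\}\to\{v,\mathcal X(-,x)\}$ along the map $\mathcal X(-,y)\to\{v,\mathcal X(-,x)\}$ induced by $f$, where $\{v,B\}$ is the cotensor, with values $\{v,B\}(z)=\mathcal W(v,Bz)$. A *$\mathcal W$-coverage* $J$ on $\mathcal X$ assigns to each object $x$ a set $J(x)$ of sieves on $x$ such that $\mathcal X(-,x)\in J(x)$, and $R_f\in J(y)$ for all $R\in J(x)$, all $g\in\mathcal G_{\mathcal W}$ and all $f:g\to\mathcal X(y,x)$. Let $\Sigma(\mathcal X,\mathcal W)$ be the complete lattice of $\mathcal W$-coverages on $\mathcal X$, ordered by $J\le K$ iff $J(x)\subseteq K(x)$ for all $x$. **Change of base.** For a $\mathcal V$-functor $K:\mathcal C^{\mathrm{op}}\to\mathcal V$ let $\widetilde G K:(G_*\mathcal C)^{\mathrm{op}}\to\mathcal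 U$ be the $\mathcal U$-functor with values $G(Kx)$ whose structure maps are the transposes of $G\mathcal C(x,y)\otimes GKy\to G(\mathcal C(x,y)\otimes Ky)\to GKx$. Then $\widetilde G(\mathcal C(-,x))=(G_*\mathcal C)(-,x)$, and applying $G$ to the components of $r:R\rightarrowtail\mathcal C(-,x)$ sends a sieve $R$ on $x\in\mathcal C$ to a sieve $\widetilde GR$ on $x\in G_*\mathcal C$. **Theorem.** Suppose that $G$ is faithful and conservative. For every $\mathcal V$-coverage $J$ on $\mathcal C$, the assignment $(\widetilde GJ)(x)=\{\widetilde GR : R\in J(x)\}$ is a $\mathcal U$-coverage on $G_*\mathcal C$, and the resulting map $$\widetilde G(-):\Sigma(\mathcal C,\mathcal V)\longrightarrow\Sigma(G_*\mathcal C,\mathcal U)$$ is an injective homomorphism of lattices. It is monotone, and it preserves the meet of every non-empty family of coverages and the join of every family of coverages. -/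

import Mathlib

open CategoryTheory MonoidalCategory Limits Opposite

universe w u₁ u₂ u₃

set_option linter.unusedSectionVars false

noncomputable section

namespace EnrichedCoverage

open scoped CategoryTheory.MonoidalClosed

/-- The standing hypotheses on a base of enrichment `W` (besides `W` being symmetric monoidal
closed, and locally small, which is expressed by `Category.{w} W`). -/
class IsNiceBase (W : Type u₁) [Category.{w} W] [MonoidalCategory W] : Prop where
  /-- `W` is locally finitely presentable. -/
  locallyFinitelyPresentable : IsLocallyFinitelyPresentable.{w} W
  /-- `W` has all small limits. -/
  hasLimits : HasLimitsOfSize.{w, w} W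
  /-- `W` has all small colimits. -/
  hasColimits : HasColimitsOfSize.{w, w} W
  /-- Finitely presentable objects are closed under tensor products. -/
  tensor_finitelyPresentable : ∀ X Y : W,
    ObjectProperty.isFinitelyPresentable.{w} W X → ObjectProperty.isFinitelyPresentable.{w} W Y →
      ObjectProperty.isFinitelyPresentable.{w} W (X ⊗ Y)
  /-- `W` is regular. -/
  regular : Regular W

instance (W : Type u₁) [Category.{w} W] [MonoidalCategory W] [h : IsNiceBase W] :
    HasPullbacks W :=
  haveI := h.hasLimits
  inferInstance

section Presheaves

variable (V : Type u₁) [Category.{w} V] [MonoidalCategory V] [SymmetricCategory V]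
  [MonoidalClosed V] (C : Type u₂) [EnrichedCategory V C]

/-- A `V`-presheaf on the `V`-category `C` is a `V`-functor `Cᵒᵖ ⥤ V`, where `V` is enriched in
itself by its internal hom. -/
structure Presheaf where
  /-- The `V`-functor. -/
  toFunctor : EnrichedFunctor V Cᵒᵖ V

variable {V C}

namespace Presheaf

/-- The value of a presheaf at an object. -/
def obj (K : Presheaf V C) (x : C) : V := K.toFunctor.obj (op x)

/-- The structure morphism `C(x, y) ⟶ [K y, K x]` of a presheaf. -/
def map (K : Presheaf V C) (x y : C) : (x ⟶[V] y) ⟶ (ihom (K.obj y)).obj (K.obj x) :=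
  K.toFunctor.map (op y) (op x)

/-- The structure morphism of a presheaf, transposed: `C(x, y) ⊗ K y ⟶ K x`. -/
def act (K : Presheaf V C) (x y : C) : (x ⟶[V] y) ⊗ K.obj y ⟶ K.obj x :=
  (β_ _ _).hom ≫ MonoidalClosed.uncurry (K.map x y)

lemma uncurry_map (K : Presheaf V C) (x y : C) :
    MonoidalClosed.uncurry (K.map x y) = (β_ _ _).hom ≫ K.act x y := by
  simp [act]

lemma act_id (K : Presheaf V C) (x : C) :
    eId V x ▷ K.obj x ≫ K.act x x = (λ_ (K.obj x)).hom := by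
  have h : eId V x ≫ K.map x x = MonoidalClosed.id (K.obj x) := K.toFunctor.map_id (op x)
  rw [act, BraidedCategory.braiding_naturality_left_assoc, ← MonoidalClosed.uncurry_natural_left,
    h, MonoidalClosed.id_eq, MonoidalClosed.uncurry_curry]
  simp

lemma uncurry_tensor_comp {a b : V} {X Y Z : V} (f : a ⟶ (ihom X).obj Y)
    (g : b ⟶ (ihom Y).obj Z) :
    MonoidalClosed.uncurry ((f ⊗ₘ g) ≫ MonoidalClosed.comp X Y Z) =
      (α_ _ _ _).inv ≫ MonoidalClosed.uncurry f ▷ b ≫ MonoidalClosed.uncurry g := by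
  rw [MonoidalClosed.uncurry_natural_left, MonoidalClosed.comp_eq, MonoidalClosed.uncurry_curry,
    MonoidalClosed.compTranspose_eq, MonoidalClosed.uncurry_eq, MonoidalClosed.uncurry_eq]
  simp [MonoidalCategory.tensorHom_def, ← whisker_exchange_assoc]

lemma symm_coherence (A B K : V) :
    (β_ (A ⊗ B) K).hom ≫ K ◁ (β_ A B).hom ≫ (α_ K B A).inv ≫ (β_ K B).hom ▷ A ≫
      (β_ (B ⊗ K) A).hom = (α_ A B K).hom := by
  have h : (α_ K B A).inv ≫ (β_ K B).hom ▷ A ≫ (β_ (B ⊗ K) A).hom =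
      (β_ K (B ⊗ A)).hom ≫ (β_ B A).hom ▷ K ≫ (α_ A B K).hom := by
    simp [BraidedCategory.braiding_tensor_left_hom, BraidedCategory.braiding_tensor_right_hom]
  rw [h, BraidedCategory.braiding_naturality_right_assoc, SymmetricCategory.symmetry_assoc,
    ← comp_whiskerRight_assoc, SymmetricCategory.symmetry]
  simp

lemma symm_coherence_act {A B K Y X : V} (f : B ⊗ K ⟶ Y) (g : A ⊗ Y ⟶ X) :
    (β_ (A ⊗ B) K).hom ≫ K ◁ (β_ A B).hom ≫ (α_ K B A).inv ≫ ((β_ K B).hom ≫ f) ▷ A ≫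
      (β_ Y A).hom ≫ g = (α_ A B K).hom ≫ A ◁ f ≫ g := by
  rw [comp_whiskerRight_assoc, BraidedCategory.braiding_naturality_left_assoc,
    ← symm_coherence A B K]
  simp only [Category.assoc]

lemma act_comp (K : Presheaf V C) (x y z : C) :
    eComp V x y z ▷ K.obj z ≫ K.act x z =
      (α_ _ _ _).hom ≫ (x ⟶[V] y) ◁ K.act y z ≫ K.act x y := by
  have h : ((β_ (y ⟶[V] z) (x ⟶[V] y)).hom ≫ eComp V x y z) ≫ K.map x z =
      (K.map y z ⊗ₘ K.map x y) ≫ MonoidalClosed.comp (K.obj z) (K.obj y) (K.obj x) :=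
    K.toFunctor.map_comp (op z) (op y) (op x)
  have h' := congrArg MonoidalClosed.uncurry h
  rw [uncurry_tensor_comp, MonoidalClosed.uncurry_natural_left, uncurry_map, uncurry_map,
    uncurry_map] at h'
  rw [← symm_coherence_act, ← h', ← whiskerLeft_comp_assoc, SymmetricCategory.symmetry_assoc,
    BraidedCategory.braiding_naturality_right_assoc, SymmetricCategory.symmetry_assoc]

section ofAct

variable (obj : C → V) (act : ∀ x y : C, (x ⟶[V] y) ⊗ obj y ⟶ obj x)

/-- The morphism `C(x, y) ⟶ [obj y, obj x]` with transpose `act x y`. -/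
def ofActMap (x y : C) : (x ⟶[V] y) ⟶ (ihom (obj y)).obj (obj x) :=
  MonoidalClosed.curry ((β_ _ _).hom ≫ act x y)

lemma ofActMap_id (h : ∀ x : C, eId V x ▷ obj x ≫ act x x = (λ_ (obj x)).hom) (x : C) :
    eId V x ≫ ofActMap obj act x x = MonoidalClosed.id (obj x) := by
  rw [ofActMap, ← MonoidalClosed.curry_natural_left, MonoidalClosed.id_eq,
    BraidedCategory.braiding_naturality_right_assoc, h]
  simp

lemma ofActMap_comp (h : ∀ x y z : C, eComp V x y z ▷ obj z ≫ act x z =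
      (α_ _ _ _).hom ≫ (x ⟶[V] y) ◁ act y z ≫ act x y) (x y z : C) :
    ((β_ (y ⟶[V] z) (x ⟶[V] y)).hom ≫ eComp V x y z) ≫ ofActMap obj act x z =
      (ofActMap obj act y z ⊗ₘ ofActMap obj act x y) ≫
        MonoidalClosed.comp (obj z) (obj y) (obj x) := by
  apply MonoidalClosed.uncurry_injective
  rw [uncurry_tensor_comp, MonoidalClosed.uncurry_natural_left, ofActMap, ofActMap, ofActMap,
    MonoidalClosed.uncurry_curry, MonoidalClosed.uncurry_curry,
    MonoidalClosed.uncurry_curry, whiskerLeft_comp_assoc,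
    BraidedCategory.braiding_naturality_right_assoc, h, ← symm_coherence_act,
    SymmetricCategory.symmetry_assoc, ← whiskerLeft_comp_assoc, SymmetricCategory.symmetry]
  simp

variable (act_id : ∀ x : C, eId V x ▷ obj x ≫ act x x = (λ_ (obj x)).hom)
  (act_comp : ∀ x y z : C, eComp V x y z ▷ obj z ≫ act x z =
      (α_ _ _ _).hom ≫ (x ⟶[V] y) ◁ act y z ≫ act x y)

/-- The presheaf with prescribed transposed structure morphisms. -/
def ofAct : Presheaf V C where
  toFunctor :=
    { obj := fun x => obj x.unop
      map := fun x y => ofActMap obj act y.unop x.unop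
      map_id := fun x => ofActMap_id obj act act_id x.unop
      map_comp := fun x y z => ofActMap_comp obj act act_comp z.unop y.unop x.unop }

lemma act_ofAct (x y : C) : (ofAct obj act act_id act_comp).act x y = act x y := by
  change (β_ (x ⟶[V] y) (obj y)).hom ≫ MonoidalClosed.uncurry (ofActMap obj act x y) = _
  rw [ofActMap, MonoidalClosed.uncurry_curry, SymmetricCategory.symmetry_assoc]

end ofAct

/-- A `V`-natural transformation of presheaves. Its components, which are morphisms
`𝟙_ V ⟶ [A x, B x]`, are given by the corresponding morphisms `A x ⟶ B x` of `V`. -/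
@[ext]
structure Hom (A B : Presheaf V C) where
  /-- The components. -/
  app : ∀ x : C, A.obj x ⟶ B.obj x
  /-- The two morphisms `C(x, y) ⟶ [A y, B x]` agree. -/
  naturality : ∀ x y : C, A.map x y ≫ (ihom (A.obj y)).map (app x) =
    B.map x y ≫ (MonoidalClosed.pre (app y)).app (B.obj x)

lemma naturality_iff {A B : Presheaf V C} (app : ∀ x : C, A.obj x ⟶ B.obj x) (x y : C) :
    A.map x y ≫ (ihom (A.obj y)).map (app x) =
      B.map x y ≫ (MonoidalClosed.pre (app y)).app (B.obj x) ↔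
    A.act x y ≫ app x = (x ⟶[V] y) ◁ app y ≫ B.act x y := by
  rw [← MonoidalClosed.uncurry_injective.eq_iff, MonoidalClosed.uncurry_natural_right,
    MonoidalClosed.uncurry_pre_app, uncurry_map, uncurry_map,
    ← cancel_epi (β_ (x ⟶[V] y) (A.obj y)).hom,
    ← BraidedCategory.braiding_naturality_right_assoc]
  simp

lemma Hom.act_app {A B : Presheaf V C} (α : Hom A B) (x y : C) :
    A.act x y ≫ α.app x = (x ⟶[V] y) ◁ α.app y ≫ B.act x y :=
  (naturality_iff α.app x y).1 (α.naturality x y)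

/-- A `V`-natural transformation, from naturality in transposed form. -/
def Hom.ofAct {A B : Presheaf V C} (app : ∀ x : C, A.obj x ⟶ B.obj x)
    (h : ∀ x y : C, A.act x y ≫ app x = (x ⟶[V] y) ◁ app y ≫ B.act x y) : Hom A B where
  app := app
  naturality x y := (naturality_iff app x y).2 (h x y)

/-- The underlying category of `[Cᵒᵖ, V]`. -/
instance : Category (Presheaf V C) where
  Hom := Hom
  id A := Hom.ofAct (fun x => 𝟙 (A.obj x)) (by simp)
  comp α β := Hom.ofAct (fun x => α.app x ≫ β.app x) (fun x y => by
    rw [reassoc_of% (α.act_app x y), β.act_app, whiskerLeft_comp_assoc])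
  id_comp _ := Hom.ext (by funext x; exact Category.id_comp _)
  comp_id _ := Hom.ext (by funext x; exact Category.comp_id _)
  assoc _ _ _ := Hom.ext (by funext x; exact Category.assoc _ _ _)

@[ext]
lemma hom_ext {A B : Presheaf V C} {α β : A ⟶ B} (h : ∀ x, α.app x = β.app x) : α = β :=
  Hom.ext (funext h)

@[simp] lemma id_app (A : Presheaf V C) (x : C) : Hom.app (𝟙 A) x = 𝟙 (A.obj x) := rfl

@[simp] lemma comp_app {A B D : Presheaf V C} (α : A ⟶ B) (β : B ⟶ D) (x : C) :
    (α ≫ β).app x = α.app x ≫ β.app x := rfl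

/-- The representable presheaf `C(-, x)`; its structure morphism is composition in `C`. -/
def representable (x : C) : Presheaf V C :=
  ofAct (fun z => z ⟶[V] x) (fun y z => eComp V y z x)
    (fun y => by
      have := e_id_comp V y x
      rwa [Iso.inv_comp_eq, Category.comp_id] at this)
    (fun y z t => by
      have := e_assoc V y z t x
      rwa [Iso.inv_comp_eq] at this)

lemma representable_act (x y z : C) : (representable x : Presheaf V C).act y z = eComp V y z x :=
  act_ofAct _ _ _ _ _ _

section swap

variable (v A B T : V)

/-- The symmetry `v ⊗ (A ⊗ T) ⟶ A ⊗ (v ⊗ T)`. -/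
def swap : v ⊗ A ⊗ T ⟶ A ⊗ v ⊗ T :=
  (α_ v A T).inv ≫ (β_ v A).hom ▷ T ≫ (α_ A v T).hom

lemma swap_naturality_right {T T' : V} (f : T ⟶ T') :
    v ◁ A ◁ f ≫ swap v A T' = swap v A T ≫ A ◁ v ◁ f := by
  simp only [swap, Category.assoc]
  rw [associator_inv_naturality_right_assoc, whisker_exchange_assoc,
    associator_naturality_right]

lemma swap_naturality_middle {A A' : V} (f : A ⟶ A') :
    v ◁ f ▷ T ≫ swap v A' T = swap v A T ≫ f ▷ (v ⊗ T) := by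
  simp only [swap, Category.assoc]
  rw [associator_inv_naturality_middle_assoc, ← comp_whiskerRight_assoc,
    BraidedCategory.braiding_naturality_right, comp_whiskerRight_assoc,
    associator_naturality_left]

lemma swap_naturality_right_assoc {T T' X : V} (f : T ⟶ T') (h : A ⊗ v ⊗ T' ⟶ X) :
    v ◁ A ◁ f ≫ swap v A T' ≫ h = swap v A T ≫ A ◁ v ◁ f ≫ h := by
  rw [reassoc_of% (swap_naturality_right v A f)]

lemma swap_naturality_middle_assoc {A A' X : V} (f : A ⟶ A') (h : A' ⊗ v ⊗ T ⟶ X) :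
    v ◁ f ▷ T ≫ swap v A' T ≫ h = swap v A T ≫ f ▷ (v ⊗ T) ≫ h := by
  rw [reassoc_of% (swap_naturality_middle v T f)]

lemma swap_unit : swap v (𝟙_ V) T = v ◁ (λ_ T).hom ≫ (λ_ (v ⊗ T)).inv := by
  simp [swap]

lemma swap_tensor : swap v (A ⊗ B) T =
    v ◁ (α_ A B T).hom ≫ swap v A (B ⊗ T) ≫ A ◁ swap v B T ≫ (α_ A B (v ⊗ T)).inv := by
  simp [swap, BraidedCategory.braiding_tensor_right_hom]

lemma braiding_eq_swap : (β_ v (A ⊗ B)).hom =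
    swap v A B ≫ A ◁ (β_ v B).hom ≫ (α_ A B v).inv := by
  simp [swap, BraidedCategory.braiding_tensor_right_hom]

end swap

/-- Evaluation `v ⊗ [v, X] ⟶ X`. -/
def ev (v X : V) : v ⊗ (ihom v).obj X ⟶ X := (ihom.ev v).app X

lemma uncurry_eq_ev {v T X : V} (t : T ⟶ (ihom v).obj X) :
    MonoidalClosed.uncurry t = v ◁ t ≫ ev v X :=
  MonoidalClosed.uncurry_eq t

/-- The morphism `C(x, y) ⊗ [v, B y] ⟶ [v, B x]` given by evaluation followed by the action. -/
def cotensorAct (v : V) (B : Presheaf V C) (x y : C) :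
    (x ⟶[V] y) ⊗ (ihom v).obj (B.obj y) ⟶ (ihom v).obj (B.obj x) :=
  MonoidalClosed.curry (swap v (x ⟶[V] y) _ ≫
    (x ⟶[V] y) ◁ ev v (B.obj y) ≫ B.act x y)

lemma uncurry_comp_cotensorAct (v : V) (B : Presheaf V C) (x y : C) {T : V}
    (t : T ⟶ (ihom v).obj (B.obj y)) :
    MonoidalClosed.uncurry ((x ⟶[V] y) ◁ t ≫ cotensorAct v B x y) =
      swap v (x ⟶[V] y) T ≫ (x ⟶[V] y) ◁ MonoidalClosed.uncurry t ≫ B.act x y := by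
  rw [MonoidalClosed.uncurry_natural_left, cotensorAct, MonoidalClosed.uncurry_curry,
    swap_naturality_right_assoc, ← whiskerLeft_comp_assoc, ← uncurry_eq_ev]

lemma cotensorAct_id (v : V) (B : Presheaf V C) (x : C) :
    eId V x ▷ (ihom v).obj (B.obj x) ≫ cotensorAct v B x x = (λ_ _).hom := by
  apply MonoidalClosed.uncurry_injective
  rw [MonoidalClosed.uncurry_natural_left, cotensorAct, MonoidalClosed.uncurry_curry,
    swap_naturality_middle_assoc, ← whisker_exchange_assoc, act_id, leftUnitor_naturality,
    swap_unit, uncurry_eq_ev]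
  simp

lemma cotensorAct_comp (v : V) (B : Presheaf V C) (x y z : C) :
    eComp V x y z ▷ (ihom v).obj (B.obj z) ≫ cotensorAct v B x z =
      (α_ _ _ _).hom ≫ (x ⟶[V] y) ◁ cotensorAct v B y z ≫ cotensorAct v B x y := by
  apply MonoidalClosed.uncurry_injective
  rw [MonoidalClosed.uncurry_natural_left, MonoidalClosed.uncurry_natural_left,
    uncurry_comp_cotensorAct, cotensorAct, cotensorAct, MonoidalClosed.uncurry_curry,
    MonoidalClosed.uncurry_curry, swap_naturality_middle_assoc, ← whisker_exchange_assoc, act_comp,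
    swap_tensor]
  simp

/-- The cotensor `{v, B}`, with value `[v, B x]` at `x`. -/
def cotensor (v : V) (B : Presheaf V C) : Presheaf V C :=
  ofAct (fun x => (ihom v).obj (B.obj x)) (cotensorAct v B) (cotensorAct_id v B)
    (cotensorAct_comp v B)

lemma cotensor_act (v : V) (B : Presheaf V C) (x y : C) :
    (cotensor v B).act x y = cotensorAct v B x y :=
  act_ofAct _ _ _ _ _ _

lemma cotensorMap_aux (v : V) {A B : Presheaf V C} (α : A ⟶ B) (x y : C) :
    cotensorAct v A x y ≫ (ihom v).map (α.app x) =
      (x ⟶[V] y) ◁ (ihom v).map (α.app y) ≫ cotensorAct v B x y := by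
  apply MonoidalClosed.uncurry_injective
  rw [MonoidalClosed.uncurry_natural_right, uncurry_comp_cotensorAct, cotensorAct,
    MonoidalClosed.uncurry_curry, MonoidalClosed.uncurry_ihom_map, Category.assoc, Category.assoc,
    α.act_app, whiskerLeft_comp_assoc]
  rfl

/-- The morphism `{v, A} ⟶ {v, B}` induced by `A ⟶ B`. -/
def cotensorMap (v : V) {A B : Presheaf V C} (α : A ⟶ B) : cotensor v A ⟶ cotensor v B :=
  Hom.ofAct (fun x => (ihom v).map (α.app x)) (fun x y => by
    rw [cotensor_act, cotensor_act]
    exact cotensorMap_aux v α x y)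

lemma cotensorMap_comp (v : V) {A B D : Presheaf V C} (α : A ⟶ B) (β : B ⟶ D) :
    cotensorMap v (α ≫ β) = cotensorMap v α ≫ cotensorMap v β := by
  ext x
  exact (ihom v).map_comp _ _

/-- The morphism `C(z, y) ⟶ [v, C(z, x)]` which is the transpose of composition with
a generalized element `f : v ⟶ C(y, x)`. -/
def elementApp {v : V} {x y : C} (f : v ⟶ (y ⟶[V] x)) (z : C) :
    (representable y).obj z ⟶ (ihom v).obj ((representable x).obj z) :=
  MonoidalClosed.curry ((β_ v (z ⟶[V] y)).hom ≫ (z ⟶[V] y) ◁ f ≫ eComp V z y x)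

lemma braiding_comp_comp {v : V} {x y : C} (f : v ⟶ (y ⟶[V] x)) (z t : C) :
    v ◁ eComp V z t y ≫ (β_ v (z ⟶[V] y)).hom ≫ (z ⟶[V] y) ◁ f ≫ eComp V z y x =
      swap v (z ⟶[V] t) (t ⟶[V] y) ≫ (z ⟶[V] t) ◁ ((β_ v (t ⟶[V] y)).hom ≫
        (t ⟶[V] y) ◁ f ≫ eComp V t y x) ≫ eComp V z t x := by
  have h := e_assoc V z t y x
  rw [Iso.inv_comp_eq] at h
  rw [BraidedCategory.braiding_naturality_right_assoc, ← whisker_exchange_assoc, h,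
    braiding_eq_swap]
  simp

lemma elementApp_aux {v : V} {x y : C} (f : v ⟶ (y ⟶[V] x)) (z t : C) :
    (representable y).act z t ≫ elementApp f z =
      (z ⟶[V] t) ◁ elementApp f t ≫ cotensorAct v (representable x) z t := by
  apply MonoidalClosed.uncurry_injective
  rw [uncurry_comp_cotensorAct, MonoidalClosed.uncurry_natural_left, elementApp, elementApp,
    MonoidalClosed.uncurry_curry, MonoidalClosed.uncurry_curry, representable_act,
    representable_act]
  exact braiding_comp_comp f z t

/-- The morphism `C(-, y) ⟶ {v, C(-, x)}` induced by a generalized element `f : v ⟶ C(y, x)`. -/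
def element {v : V} {x y : C} (f : v ⟶ (y ⟶[V] x)) :
    (representable y : Presheaf V C) ⟶ cotensor v (representable x) :=
  Hom.ofAct (elementApp f) (fun z t => by
    rw [cotensor_act]
    exact elementApp_aux f z t)

section pullback

variable [HasPullbacks V] {A B D : Presheaf V C} (α : A ⟶ D) (β : B ⟶ D)

lemma pullbackAct_aux (x y : C) :
    ((x ⟶[V] y) ◁ pullback.fst (α.app y) (β.app y) ≫ A.act x y) ≫ α.app x =
      ((x ⟶[V] y) ◁ pullback.snd (α.app y) (β.app y) ≫ B.act x y) ≫ β.app x := by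
  rw [Category.assoc, Category.assoc, α.act_app, β.act_app, ← whiskerLeft_comp_assoc,
    ← whiskerLeft_comp_assoc, pullback.condition]

/-- The structure morphism of the pointwise pullback. -/
def pullbackAct (x y : C) : (x ⟶[V] y) ⊗ pullback (α.app y) (β.app y) ⟶
    pullback (α.app x) (β.app x) :=
  pullback.lift _ _ (pullbackAct_aux α β x y)

lemma pullbackAct_fst (x y : C) : pullbackAct α β x y ≫ pullback.fst (α.app x) (β.app x) =
    (x ⟶[V] y) ◁ pullback.fst (α.app y) (β.app y) ≫ A.act x y :=
  pullback.lift_fst _ _ _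

lemma pullbackAct_snd (x y : C) : pullbackAct α β x y ≫ pullback.snd (α.app x) (β.app x) =
    (x ⟶[V] y) ◁ pullback.snd (α.app y) (β.app y) ≫ B.act x y :=
  pullback.lift_snd _ _ _

/-- The pullback of `α : A ⟶ D` and `β : B ⟶ D`, formed pointwise. -/
def pullbackPresheaf : Presheaf V C :=
  ofAct (fun x => pullback (α.app x) (β.app x)) (pullbackAct α β)
    (fun x => by
      apply pullback.hom_ext
      · rw [Category.assoc, pullbackAct_fst, ← whisker_exchange_assoc, act_id,
          leftUnitor_naturality]
      · rw [Category.assoc, pullbackAct_snd, ← whisker_exchange_assoc, act_id,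
          leftUnitor_naturality])
    (fun x y z => by
      apply pullback.hom_ext
      · simp only [Category.assoc, pullbackAct_fst]
        rw [← whisker_exchange_assoc, act_comp, ← whiskerLeft_comp_assoc, pullbackAct_fst]
        simp
      · simp only [Category.assoc, pullbackAct_snd]
        rw [← whisker_exchange_assoc, act_comp, ← whiskerLeft_comp_assoc, pullbackAct_snd]
        simp)

lemma pullbackPresheaf_act (x y : C) : (pullbackPresheaf α β).act x y = pullbackAct α β x y :=
  act_ofAct _ _ _ _ _ _

/-- The first projection of the pullback. -/
def pullbackFst : pullbackPresheaf α β ⟶ A :=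
  Hom.ofAct (fun x => pullback.fst (α.app x) (β.app x)) (fun x y => by
    rw [pullbackPresheaf_act]
    exact pullbackAct_fst α β x y)

section pullbackMap

variable {B' : Presheaf V C} {β' : B' ⟶ D} (τ : B ⟶ B') (h : τ ≫ β' = β)

/-- The components of `pullbackMap`. -/
def pullbackMapApp (x : C) : pullback (α.app x) (β.app x) ⟶ pullback (α.app x) (β'.app x) :=
  pullback.lift (pullback.fst (α.app x) (β.app x)) (pullback.snd (α.app x) (β.app x) ≫ τ.app x)
    (by rw [pullback.condition, Category.assoc, ← comp_app, h])

lemma pullbackMapApp_fst (x : C) : pullbackMapApp α β τ h x ≫ pullback.fst (α.app x) (β'.app x) =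
    pullback.fst (α.app x) (β.app x) :=
  pullback.lift_fst _ _ _

lemma pullbackMapApp_snd (x : C) : pullbackMapApp α β τ h x ≫ pullback.snd (α.app x) (β'.app x) =
    pullback.snd (α.app x) (β.app x) ≫ τ.app x :=
  pullback.lift_snd _ _ _

lemma pullbackMapApp_naturality (x y : C) :
    pullbackAct α β x y ≫ pullbackMapApp α β τ h x =
      (x ⟶[V] y) ◁ pullbackMapApp α β τ h y ≫ pullbackAct α β' x y := by
  apply pullback.hom_ext
  · rw [Category.assoc, Category.assoc, pullbackMapApp_fst, pullbackAct_fst, pullbackAct_fst,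
      ← whiskerLeft_comp_assoc, pullbackMapApp_fst]
  · rw [Category.assoc, Category.assoc, pullbackMapApp_snd, pullbackAct_snd,
      reassoc_of% (pullbackAct_snd α β x y), ← whiskerLeft_comp_assoc, pullbackMapApp_snd,
      τ.act_app, whiskerLeft_comp_assoc]

/-- The morphism of pullbacks induced by a morphism over `D` in the second variable. -/
def pullbackMap : pullbackPresheaf α β ⟶ pullbackPresheaf α β' :=
  Hom.ofAct (pullbackMapApp α β τ h) (fun x y => by
    rw [pullbackPresheaf_act, pullbackPresheaf_act]
    exact pullbackMapApp_naturality α β τ h x y)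

lemma pullbackMap_fst : pullbackMap α β τ h ≫ pullbackFst α β' = pullbackFst α β := by
  ext x
  exact pullback.lift_fst _ _ _

end pullbackMap

end pullback

end Presheaf

/-- A monomorphism into `K`: a `V`-natural transformation to `K` all of whose components are
monomorphisms. -/
structure MonoInto (K : Presheaf V C) where
  /-- The domain. -/
  dom : Presheaf V C
  /-- The `V`-natural transformation. -/
  hom : dom ⟶ K
  /-- Its components are monomorphisms. -/
  mono : ∀ x : C, Mono (hom.app x)

/-- Two monomorphisms into `K` are equivalent if they differ by an isomorphism of domains. -/
instance MonoInto.setoid (K : Presheaf V C) : Setoid (MonoInto K) where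
  r R S := ∃ t : R.dom ≅ S.dom, t.hom ≫ S.hom = R.hom
  iseqv :=
    { refl := fun R => ⟨Iso.refl _, by simp⟩
      symm := fun {R S} ⟨t, ht⟩ => ⟨t.symm, by simp [← ht]⟩
      trans := fun {R S T} ⟨t, ht⟩ ⟨t', ht'⟩ => ⟨t ≪≫ t', by simp [ht, ht']⟩ }

lemma MonoInto.equiv_of_factor {K : Presheaf V C} {R S : MonoInto K} (σ : R.dom ⟶ S.dom)
    (τ : S.dom ⟶ R.dom) (hσ : σ ≫ S.hom = R.hom) (hτ : τ ≫ R.hom = S.hom) : R ≈ S := by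
  refine ⟨⟨σ, τ, ?_, ?_⟩, hσ⟩
  · ext x
    have := R.mono x
    rw [← cancel_mono (R.hom.app x), Presheaf.comp_app, Category.assoc, ← Presheaf.comp_app, hτ,
      ← Presheaf.comp_app, hσ]
    simp
  · ext x
    have := S.mono x
    rw [← cancel_mono (S.hom.app x), Presheaf.comp_app, Category.assoc, ← Presheaf.comp_app, hσ,
      ← Presheaf.comp_app, hτ]
    simp

/-- The subobjects of a presheaf `K`. -/
def Sub (K : Presheaf V C) : Type _ := Quotient (MonoInto.setoid K)

/-- A sieve on `x` is a subobject of `C(-, x)`. -/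
abbrev Sieve (V : Type u₁) [Category.{w} V] [MonoidalCategory V] [SymmetricCategory V]
    [MonoidalClosed V] {C : Type u₂} [EnrichedCategory V C] (x : C) : Type _ :=
  Sub (Presheaf.representable x : Presheaf V C)

/-- The maximal sieve `C(-, x)` on `x`. -/
def Sieve.max (x : C) : Sieve V x :=
  Quotient.mk _ ⟨Presheaf.representable x, 𝟙 _, fun _ => by dsimp; infer_instance⟩

section pullbackSieve

variable [HasPullbacks V] {v : V} {x y : C} (f : v ⟶ (y ⟶[V] x))

/-- The pullback of `{v, R} ⟶ {v, C(-, x)}` along `f : C(-, y) ⟶ {v, C(-, x)}`. -/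
def MonoInto.pullback (R : MonoInto (Presheaf.representable x : Presheaf V C)) :
    MonoInto (Presheaf.representable y : Presheaf V C) where
  dom := Presheaf.pullbackPresheaf (Presheaf.element f) (Presheaf.cotensorMap v R.hom)
  hom := Presheaf.pullbackFst (Presheaf.element f) (Presheaf.cotensorMap v R.hom)
  mono z := by
    have := R.mono z
    have : Mono ((Presheaf.cotensorMap v R.hom).app z) :=
      inferInstanceAs (Mono ((ihom v).map (R.hom.app z)))
    exact pullback.fst_of_mono

lemma MonoInto.pullback_equiv {R S : MonoInto (Presheaf.representable x : Presheaf V C)}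
    (h : R ≈ S) : R.pullback f ≈ S.pullback f := by
  obtain ⟨t, ht⟩ := h
  have ht' : t.inv ≫ R.hom = S.hom := by simp [← ht]
  have h₁ : Presheaf.cotensorMap v t.hom ≫ Presheaf.cotensorMap v S.hom =
      Presheaf.cotensorMap v R.hom := by rw [← Presheaf.cotensorMap_comp, ht]
  have h₂ : Presheaf.cotensorMap v t.inv ≫ Presheaf.cotensorMap v R.hom =
      Presheaf.cotensorMap v S.hom := by rw [← Presheaf.cotensorMap_comp, ht']
  exact equiv_of_factor (Presheaf.pullbackMap _ _ _ h₁) (Presheaf.pullbackMap _ _ _ h₂)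
    (Presheaf.pullbackMap_fst _ _ _ h₁) (Presheaf.pullbackMap_fst _ _ _ h₂)

/-- The pullback sieve `R_f` on `y` of a sieve `R` on `x` along a generalized element
`f : v ⟶ C(y, x)`. -/
def Sieve.pullback (R : Sieve V x) : Sieve V y :=
  Quotient.map (MonoInto.pullback f) (fun _ _ h => MonoInto.pullback_equiv f h) R

end pullbackSieve

end Presheaves

section Coverages

/-- A `V`-coverage on `C`, with respect to a family `𝓖` of objects of `V`: a family of sieves on
each object of `C`, containing the maximal sieves and stable under pullback along generalized
elements `g ⟶ C(y, x)` with `g` in `𝓖`. -/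
@[ext]
structure Coverage {V : Type u₁} [Category.{w} V] [MonoidalCategory V] [SymmetricCategory V]
    [MonoidalClosed V] [HasPullbacks V] (𝓖 : ObjectProperty V) (C : Type u₂)
    [EnrichedCategory V C] where
  /-- The covering sieves. -/
  sieves : ∀ x : C, Set (Sieve V x)
  max_mem : ∀ x : C, Sieve.max x ∈ sieves x
  pullback_mem : ∀ (x y : C) (R : Sieve V x), R ∈ sieves x →
    ∀ (g : V), 𝓖 g → ∀ f : g ⟶ (y ⟶[V] x), R.pullback f ∈ sieves y

variable {V : Type u₁} [Category.{w} V] [MonoidalCategory V] [SymmetricCategory V]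
  [MonoidalClosed V] [HasPullbacks V] {𝓖 : ObjectProperty V} {C : Type u₂} [EnrichedCategory V C]

namespace Coverage

/-- Coverages are ordered by refinement: `J ≤ K` if `J(x) ⊆ K(x)` for all `x`. -/
instance : PartialOrder (Coverage 𝓖 C) where
  le J K := ∀ x, J.sieves x ⊆ K.sieves x
  le_refl _ _ := subset_rfl
  le_trans _ _ _ h h' x := (h x).trans (h' x)
  le_antisymm _ _ h h' := Coverage.ext (funext fun x => (h x).antisymm (h' x))

/-- The infimum of a family of coverages is the pointwise intersection. -/
instance : InfSet (Coverage 𝓖 C) where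
  sInf S :=
    { sieves := fun x => ⋂ J ∈ S, J.sieves x
      max_mem := fun x => Set.mem_iInter₂.2 fun J _ => J.max_mem x
      pullback_mem := fun x y R hR g hg f => Set.mem_iInter₂.2 fun J hJ =>
        J.pullback_mem x y R (Set.mem_iInter₂.1 hR J hJ) g hg f }

/-- The complete lattice `Σ(C, V)` of coverages. -/
instance : CompleteLattice (Coverage 𝓖 C) :=
  completeLatticeOfInf _ fun _ =>
    ⟨fun _ hJ _ => Set.biInter_subset_of_mem hJ,
      fun _ hK x => Set.subset_iInter₂ fun _ hJ => hK hJ x⟩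

end Coverage

end Coverages

section ChangeOfBase

variable {V : Type u₁} [Category.{w} V] [MonoidalCategory V] [SymmetricCategory V]
  [MonoidalClosed V] {U : Type u₂} [Category.{w} U] [MonoidalCategory U] [SymmetricCategory U]
  [MonoidalClosed U] {F : U ⥤ V} (G : V ⥤ U) [G.LaxMonoidal] {C : Type u₃} [EnrichedCategory V C]

open Functor.LaxMonoidal

namespace Presheaf

/-- The morphism `G C(x, y) ⊗ G (K y) ⟶ G (C(x, y) ⊗ K y) ⟶ G (K x)`. -/
def changeOfBaseAct (K : Presheaf V C) (x y : C) :
    G.obj (x ⟶[V] y) ⊗ G.obj (K.obj y) ⟶ G.obj (K.obj x) :=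
  μ G _ _ ≫ G.map (K.act x y)

lemma changeOfBaseAct_id (K : Presheaf V C) (x : C) :
    (ε G ≫ G.map (eId V x)) ▷ G.obj (K.obj x) ≫ changeOfBaseAct G K x x = (λ_ _).hom := by
  rw [changeOfBaseAct, comp_whiskerRight_assoc, μ_natural_left_assoc, ← G.map_comp, act_id]
  simp

lemma changeOfBaseAct_comp (K : Presheaf V C) (x y z : C) :
    (μ G _ _ ≫ G.map (eComp V x y z)) ▷ G.obj (K.obj z) ≫ changeOfBaseAct G K x z =
      (α_ _ _ _).hom ≫ G.obj (x ⟶[V] y) ◁ changeOfBaseAct G K y z ≫ changeOfBaseAct G K x y := by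
  simp only [changeOfBaseAct]
  rw [comp_whiskerRight_assoc, μ_natural_left_assoc, ← G.map_comp, act_comp,
    whiskerLeft_comp_assoc, μ_natural_right_assoc, G.map_comp, G.map_comp,
    associativity_assoc]

/-- Change of base for presheaves: the `U`-presheaf `G̃ K` on `G_* C` with values `G (K x)`. -/
def changeOfBase (K : Presheaf V C) : Presheaf U (TransportEnrichment G C) :=
  ofAct (C := TransportEnrichment G C) (fun x => G.obj (K.obj x)) (changeOfBaseAct G K)
    (changeOfBaseAct_id G K) (changeOfBaseAct_comp G K)

lemma changeOfBase_act (K : Presheaf V C) (x y : C) :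
    (changeOfBase G K).act (C := TransportEnrichment G C) x y = changeOfBaseAct G K x y :=
  act_ofAct (C := TransportEnrichment G C) _ _ _ _ _ _

/-- The canonical morphism `G [X, Y] ⟶ [G X, G Y]`, the action on hom-objects of the `U`-functor
`G_* V ⟶ U` induced by `G`. -/
def homComparison (X Y : V) : G.obj ((ihom X).obj Y) ⟶ (ihom (G.obj X)).obj (G.obj Y) :=
  MonoidalClosed.curry (μ G _ _ ≫ G.map (ev X Y))

/-- If `G` is symmetric, then `G̃ K` is the composite of `G_* K` with `G_* V ⟶ U`. -/
lemma changeOfBase_map {G : V ⥤ U} [G.LaxBraided]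
    (K : Presheaf V C) (x y : C) :
    (changeOfBase G K).map (C := TransportEnrichment G C) x y =
      G.map (K.map x y) ≫ homComparison G (K.obj y) (K.obj x) := by
  change ofActMap (C := TransportEnrichment G C) (fun x => G.obj (K.obj x))
    (changeOfBaseAct G K) x y = _
  have h : MonoidalClosed.curry ((β_ (G.obj (K.obj y)) (G.obj (x ⟶[V] y))).hom ≫
      changeOfBaseAct G K x y) = G.map (K.map x y) ≫ homComparison G (K.obj y) (K.obj x) := by
    rw [homComparison, ← MonoidalClosed.curry_natural_left, changeOfBaseAct,
      ← Functor.LaxBraided.braided_assoc, μ_natural_right_assoc, ← G.map_comp, ← G.map_comp,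
      ← uncurry_eq_ev, uncurry_map]
  exact h

lemma changeOfBaseAct_naturality {A B : Presheaf V C} (α : A ⟶ B) (x y : C) :
    changeOfBaseAct G A x y ≫ G.map (α.app x) =
      G.obj (x ⟶[V] y) ◁ G.map (α.app y) ≫ changeOfBaseAct G B x y := by
  rw [changeOfBaseAct, changeOfBaseAct, μ_natural_right_assoc, ← G.map_comp, Category.assoc,
    ← G.map_comp, α.act_app]

/-- The action of `G̃` on morphisms. -/
def changeOfBaseMap {A B : Presheaf V C} (α : A ⟶ B) : changeOfBase G A ⟶ changeOfBase G B :=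
  Hom.ofAct (C := TransportEnrichment G C) (fun x => G.map (α.app x)) (fun x y =>
    (congrArg (fun k => k ≫ G.map (α.app x)) (changeOfBase_act G A x y)).trans
      ((changeOfBaseAct_naturality G α x y).trans
        (congrArg (fun k => G.obj (EnrichedCategory.Hom (V := V) (C := C) x y) ◁
          G.map (α.app y) ≫ k) (changeOfBase_act G B x y).symm)))

lemma changeOfBaseMap_comp {A B D : Presheaf V C} (α : A ⟶ B) (β : B ⟶ D) :
    changeOfBaseMap G (α ≫ β) = changeOfBaseMap G α ≫ changeOfBaseMap G β := by
  ext x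
  exact G.map_comp _ _

lemma changeOfBaseMap_id (A : Presheaf V C) : changeOfBaseMap G (𝟙 A) = 𝟙 _ := by
  ext x
  exact G.map_id _

lemma changeOfBase_representable_act (x y z : C) :
    (changeOfBase G (representable x)).act (C := TransportEnrichment G C) y z =
      (representable (C := TransportEnrichment G C) x : Presheaf U _).act y z := by
  refine (changeOfBase_act G (representable x) y z).trans ?_
  refine Eq.trans ?_ (representable_act (C := TransportEnrichment G C) x y z).symm
  rw [changeOfBaseAct, representable_act]
  rfl

/-- The canonical identification of `G̃ (C(-, x))` with `(G_* C)(-, x)`, with identity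
components. -/
def changeOfBaseRepresentable (x : C) :
    changeOfBase G (representable x : Presheaf V C) ≅
      (representable (C := TransportEnrichment G C) x : Presheaf U (TransportEnrichment G C)) where
  hom := Hom.ofAct (C := TransportEnrichment G C)
    (fun y => 𝟙 (G.obj (EnrichedCategory.Hom (V := V) (C := C) y x))) (fun y z => by
      refine (Category.comp_id _).trans ((changeOfBase_representable_act G x y z).trans ?_)
      exact ((congrArg (· ≫ _) (MonoidalCategory.whiskerLeft_id _ _)).trans
        (Category.id_comp _)).symm)
  inv := Hom.ofAct (C := TransportEnrichment G C)
    (fun y => 𝟙 (G.obj (EnrichedCategory.Hom (V := V) (C := C) y x))) (fun y z => by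
      refine (Category.comp_id _).trans ((changeOfBase_representable_act G x y z).symm.trans ?_)
      exact ((congrArg (· ≫ _) (MonoidalCategory.whiskerLeft_id _ _)).trans
        (Category.id_comp _)).symm)
  hom_inv_id := by
    ext y
    exact Category.comp_id _
  inv_hom_id := by
    ext y
    exact Category.comp_id _

end Presheaf

variable {G}

/-- `G̃` on monomorphisms into a presheaf; `G` preserves monomorphisms, being a right adjoint. -/
def MonoInto.changeOfBase (adj : F ⊣ G) {K : Presheaf V C} (R : MonoInto K) :
    MonoInto (Presheaf.changeOfBase G K) where
  dom := Presheaf.changeOfBase G R.dom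
  hom := Presheaf.changeOfBaseMap G R.hom
  mono x := by
    have := R.mono x
    have := adj.rightAdjoint_preservesLimits
    exact inferInstanceAs (Mono (G.map (R.hom.app x)))

/-- `G̃` on subobjects of a presheaf. -/
def Sub.changeOfBase (adj : F ⊣ G) {K : Presheaf V C} (R : Sub K) :
    Sub (Presheaf.changeOfBase G K) :=
  Quotient.map (MonoInto.changeOfBase adj) (fun R S h => by
    obtain ⟨t, ht⟩ := h
    refine ⟨⟨Presheaf.changeOfBaseMap G t.hom, Presheaf.changeOfBaseMap G t.inv, ?_, ?_⟩, ?_⟩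
    · exact (Presheaf.changeOfBaseMap_comp G t.hom t.inv).symm.trans
        ((congrArg (Presheaf.changeOfBaseMap G) t.hom_inv_id).trans
          (Presheaf.changeOfBaseMap_id G R.dom))
    · exact (Presheaf.changeOfBaseMap_comp G t.inv t.hom).symm.trans
        ((congrArg (Presheaf.changeOfBaseMap G) t.inv_hom_id).trans
          (Presheaf.changeOfBaseMap_id G S.dom))
    · exact (Presheaf.changeOfBaseMap_comp G t.hom S.hom).symm.trans
        (congrArg (Presheaf.changeOfBaseMap G) ht)) R

end ChangeOfBase

section Transport

variable {V : Type u₁} [Category.{w} V] [MonoidalCategory V] [SymmetricCategory V]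
  [MonoidalClosed V] {C : Type u₂} [EnrichedCategory V C]

/-- Transport of monomorphisms along an isomorphism of their codomains. -/
def MonoInto.postcomp {K L : Presheaf V C} (e : K ≅ L) (R : MonoInto K) : MonoInto L where
  dom := R.dom
  hom := R.hom ≫ e.hom
  mono x := by
    have := R.mono x
    have h : e.hom.app x ≫ e.inv.app x = 𝟙 _ := by
      rw [← Presheaf.comp_app, e.hom_inv_id, Presheaf.id_app]
    have : Mono (e.hom.app x) := mono_of_mono_fac h
    exact mono_comp (R.hom.app x) (e.hom.app x)

/-- Transport of subobjects along an isomorphism of presheaves. -/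
def Sub.postcomp {K L : Presheaf V C} (e : K ≅ L) (R : Sub K) : Sub L :=
  Quotient.map (MonoInto.postcomp e) (fun R S h => by
    obtain ⟨t, ht⟩ := h
    exact ⟨t, (Category.assoc _ _ _).symm.trans (congrArg (· ≫ e.hom) ht)⟩) R

end Transport

/-- `G̃` on sieves: the sieve `G̃ R` on the object `x` of `G_* C`, where `G̃ (C(-, x))` is identified
with `(G_* C)(-, x)`. -/
def Sieve.changeOfBase {V : Type u₁} [Category.{w} V] [MonoidalCategory V] [SymmetricCategory V]
    [MonoidalClosed V] {U : Type u₂} [Category.{w} U] [MonoidalCategory U] [SymmetricCategory U]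
    [MonoidalClosed U] {F : U ⥤ V} {G : V ⥤ U} [G.LaxMonoidal] (adj : F ⊣ G)
    {C : Type u₃} [EnrichedCategory V C] {x : C} (R : Sieve V x) :
    Sieve U (C := TransportEnrichment G C) x :=
  Sub.postcomp (Presheaf.changeOfBaseRepresentable G x) (Sub.changeOfBase adj R)

/-- A set of finitely presentable objects of `W` that generates `W`. -/
structure IsGeneratingFamily {W : Type u₁} [Category.{w} W] (𝓖 : ObjectProperty W) : Prop where
  /-- Up to isomorphism, the family is a small set. -/
  small : ObjectProperty.EssentiallySmall.{w} 𝓖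
  /-- Its members are finitely presentable. -/
  finitelyPresentable : 𝓖 ≤ ObjectProperty.isFinitelyPresentable.{w} W
  /-- Morphisms out of its members distinguish parallel morphisms. -/
  separating : 𝓖.IsSeparating

end EnrichedCoverage

end

/-! A subobject `R` of a presheaf `K` is determined by the generalized elements `T ⟶ K x` that
factor through it, so every comparison of sieves becomes a comparison of elements
(`MonoInto.equiv_iff_contains`). In these terms `a` lies in `R_f` exactly when the composite of `a ⊗
f` with composition in `C` lies in `R` (`contains_pullback_iff`), and `a : T ⟶ G C(z, x)` lies in
`G̃ R` exactly when its transpose `F T ⟶ C(z, x)` lies in `R` (`contains_changeOfBaseSieve_iff`).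

Since the adjunction is monoidal, `F` preserves tensor products up to isomorphism. Hence the two
descriptions combine to show that pulling `G̃ R` back along `f` is `G̃` of the pullback of `R` along
the transpose of `f` (`Sieve.changeOfBase_pullback`). The domain of that transpose is `F g`, which
belongs to `𝓖V`, so `G̃ J` is a coverage.

`G̃` is injective on sieves: if `G̃ R` and `G̃ S` agree, the counit at `R z` factors through the
intersection of `R` and `S` at `z`, and conservativity of `G` makes the inclusion of that
intersection into `R z` invertible. Meets of coverages are intersections and joins are unions with
the maximal sieves added. Direct images preserve such joins, and injective direct images preserve
non-empty intersections. -/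

namespace EnrichedCoverage

open scoped CategoryTheory.MonoidalClosed

/-! ### Subobjects of presheaves through generalized elements -/

section Elements

variable {V : Type u₁} [Category.{w} V] [MonoidalCategory V] [SymmetricCategory V]
  [MonoidalClosed V] {C : Type u₂} [EnrichedCategory V C]

namespace MonoInto

/-- The generalized element `a : T ⟶ K x` belongs to the subobject `R` of `K`. -/
def Contains {K : Presheaf V C} (R : MonoInto K) {x : C} {T : V} (a : T ⟶ K.obj x) : Prop :=
  ∃ b : T ⟶ R.dom.obj x, b ≫ R.hom.app x = a

lemma Contains.comp {K : Presheaf V C} {R : MonoInto K} {x : C} {T T' : V} {a : T ⟶ K.obj x}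
    (h : R.Contains a) (p : T' ⟶ T) : R.Contains (p ≫ a) := by
  obtain ⟨b, rfl⟩ := h
  exact ⟨p ≫ b, Category.assoc _ _ _⟩

lemma contains_iso_comp_iff {K : Presheaf V C} (R : MonoInto K) {x : C} {T T' : V}
    (a : T ⟶ K.obj x) (p : T' ⟶ T) [IsIso p] : R.Contains (p ≫ a) ↔ R.Contains a := by
  refine ⟨fun h => ?_, fun h => h.comp p⟩
  simpa using h.comp (inv p)

/-- Factorizations chosen independently at each object are automatically natural, because the
components of `S.hom` are monomorphisms and naturality may be checked after composing with them. -/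
lemma exists_hom_of_app {K : Presheaf V C} {R S : MonoInto K}
    (h : ∀ x, S.Contains (R.hom.app x)) : ∃ σ : R.dom ⟶ S.dom, σ ≫ S.hom = R.hom := by
  choose σ hσ using h
  refine ⟨Presheaf.Hom.ofAct σ fun x y => ?_, Presheaf.hom_ext hσ⟩
  have := S.mono x
  rw [← cancel_mono (S.hom.app x), Category.assoc, hσ, Presheaf.Hom.act_app, Category.assoc,
    Presheaf.Hom.act_app, ← whiskerLeft_comp_assoc, hσ]

/-- Equivalence of monomorphisms is detected by generalized elements. -/
lemma equiv_iff_contains {K : Presheaf V C} {R S : MonoInto K} :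
    R ≈ S ↔ ∀ (x : C) (T : V) (a : T ⟶ K.obj x), R.Contains a ↔ S.Contains a := by
  constructor
  · rintro ⟨t, ht⟩ x T a
    have ht' : t.inv ≫ R.hom = S.hom := by simp [← ht]
    constructor
    · rintro ⟨b, rfl⟩
      exact ⟨b ≫ t.hom.app x, by rw [Category.assoc, ← Presheaf.comp_app, ht]⟩
    · rintro ⟨b, rfl⟩
      exact ⟨b ≫ t.inv.app x, by rw [Category.assoc, ← Presheaf.comp_app, ht']⟩
  · intro h
    -- The universal element of `R` at `x` is `R.hom.app x` itself; its membership in `S` is the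
    -- required factorization.
    obtain ⟨σ, hσ⟩ := exists_hom_of_app fun x => (h x _ (R.hom.app x)).1 ⟨𝟙 _, Category.id_comp _⟩
    obtain ⟨τ, hτ⟩ := exists_hom_of_app fun x => (h x _ (S.hom.app x)).2 ⟨𝟙 _, Category.id_comp _⟩
    exact equiv_of_factor σ τ hσ hτ

/-- A generalized element `a : T ⟶ C(z, y)` belongs to `R_f` if and only if the composite
`T ⊗ v ⟶ C(z, y) ⊗ C(y, x) ⟶ C(z, x)` belongs to `R`. -/
lemma contains_pullback_iff [HasPullbacks V] {v : V} {x y z : C} (f : v ⟶ (y ⟶[V] x))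
    (R : MonoInto (Presheaf.representable x : Presheaf V C)) {T : V} (a : T ⟶ (z ⟶[V] y)) :
    (R.pullback f).Contains (x := z) a ↔ R.Contains (x := z) ((a ⊗ₘ f) ≫ eComp V z y x) := by
  -- Currying places `v` on the left, whereas composition takes the element of `C(z, y)` first; the
  -- braiding accounts for the difference, and being invertible it does not affect membership.
  have key : MonoidalClosed.uncurry (a ≫ Presheaf.elementApp f z) =
      (β_ v T).hom ≫ (a ⊗ₘ f) ≫ eComp V z y x := by
    refine (MonoidalClosed.uncurry_natural_left _ _).trans ?_
    refine (congrArg (v ◁ a ≫ ·) (MonoidalClosed.uncurry_curry _)).trans ?_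
    refine (BraidedCategory.braiding_naturality_right_assoc _ _ _).trans ?_
    exact congrArg ((β_ v T).hom ≫ ·) (tensorHom_def_assoc a f _).symm
  rw [← contains_iso_comp_iff R _ (β_ v T).hom]
  constructor
  · rintro ⟨b, hb⟩
    let s := b ≫ pullback.snd ((Presheaf.element f).app z)
      ((Presheaf.cotensorMap v R.hom).app z)
    refine ⟨MonoidalClosed.uncurry s, ?_⟩
    refine Eq.trans ?_ key
    rw [← hb]
    refine (MonoidalClosed.uncurry_natural_right _ _).symm.trans
      (congrArg MonoidalClosed.uncurry ?_)
    refine (Category.assoc _ _ _).trans ?_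
    refine Eq.trans ?_ (Category.assoc _ _ _).symm
    exact congrArg (b ≫ ·) (pullback.condition (f := (Presheaf.element f).app z)
      (g := (Presheaf.cotensorMap v R.hom).app z)).symm
  · rintro ⟨b, hb⟩
    -- An element of the pointwise pullback over `a` amounts to a map `T ⟶ [v, R z]`, obtained here
    -- by currying the given factorization `b`.
    refine ⟨pullback.lift (f := (Presheaf.element f).app z)
      (g := (Presheaf.cotensorMap v R.hom).app z) a (MonoidalClosed.curry b) ?_,
      pullback.lift_fst _ _ _⟩
    apply MonoidalClosed.uncurry_injective
    refine key.trans (hb.symm.trans ?_)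
    refine Eq.trans ?_ (MonoidalClosed.uncurry_natural_right _ _).symm
    rw [MonoidalClosed.uncurry_curry]

end MonoInto

lemma Sieve.pullback_max [HasPullbacks V] {v : V} {x y : C} (f : v ⟶ (y ⟶[V] x)) :
    (Sieve.max x : Sieve V x).pullback f = Sieve.max y := by
  refine Quotient.sound (MonoInto.equiv_iff_contains.2 fun z T a => ?_)
  refine (MonoInto.contains_pullback_iff f _ a).trans ?_
  exact iff_of_true ⟨_, Category.comp_id _⟩ ⟨a, Category.comp_id _⟩

end Elements

/-! ### Meets and joins of coverages -/

section Lattice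

variable {V : Type u₁} [Category.{w} V] [MonoidalCategory V] [SymmetricCategory V]
  [MonoidalClosed V] [HasPullbacks V] {𝓖 : ObjectProperty V} {C : Type u₂} [EnrichedCategory V C]

namespace Coverage

lemma sieves_sInf (S : Set (Coverage 𝓖 C)) (x : C) :
    (sInf S).sieves x = ⋂ J ∈ S, J.sieves x := rfl

/-- The join of a family of coverages is the pointwise union, with the maximal sieves added. -/
lemma sieves_sSup (S : Set (Coverage 𝓖 C)) (x : C) :
    (sSup S).sieves x = insert (Sieve.max x) (⋃ J ∈ S, J.sieves x) := by
  -- Stability under pullback constrains one sieve at a time, so a union of coverages is again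
  -- stable. The maximal sieves have to be added only for the empty family, and they are stable by
  -- `Sieve.pullback_max`.
  let K : Coverage 𝓖 C :=
    { sieves := fun x => insert (Sieve.max x) (⋃ J ∈ S, J.sieves x)
      max_mem := fun x => Set.mem_insert _ _
      pullback_mem := by
        rintro x y R (rfl | hR) g hg f
        · exact Or.inl (Sieve.pullback_max f)
        · obtain ⟨J, hJ, hR⟩ := Set.mem_iUnion₂.1 hR
          exact Or.inr (Set.mem_iUnion₂.2 ⟨J, hJ, J.pullback_mem x y R hR g hg f⟩) }
  apply Set.Subset.antisymm
  · have h : sSup S ≤ K := sSup_le fun J hJ x R hR => Or.inr (Set.mem_iUnion₂.2 ⟨J, hJ, hR⟩)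
    exact h x
  · rintro R (rfl | hR)
    · exact (sSup S).max_mem x
    · obtain ⟨J, hJ, hR⟩ := Set.mem_iUnion₂.1 hR
      exact (le_sSup hJ : J ≤ sSup S) x hR

end Coverage

end Lattice

/-! ### Monoidal adjunctions: the left adjoint is strong on tensor products -/

section MonoidalAdjunction

variable {V : Type u₁} [Category.{w} V] [MonoidalCategory V]
  {U : Type u₂} [Category.{w} U] [MonoidalCategory U]
  {F : U ⥤ V} [F.LaxMonoidal] {G : V ⥤ U} [G.LaxMonoidal] (adj : F ⊣ G)

open CategoryTheory.Functor.LaxMonoidal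

/-- The map following `μ F X Y` is the mate of the lax structure of `G`, the candidate inverse.
Naturality of `μ F` and monoidality of the counit reduce the composite to a tensor product of two
triangle identities. -/
lemma μ_comp_map_unit_comp_counit [NatTrans.IsMonoidal adj.counit] (X Y : U) :
    μ F X Y ≫ F.map ((adj.unit.app X ⊗ₘ adj.unit.app Y) ≫ μ G (F.obj X) (F.obj Y)) ≫
      adj.counit.app (F.obj X ⊗ F.obj Y) = 𝟙 _ := by
  have h := NatTrans.IsMonoidal.tensor (τ := adj.counit) (F.obj X) (F.obj Y)
  simp only [comp_μ, id_μ, Functor.id_obj, Functor.comp_obj, Category.assoc,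
    Category.comp_id] at h
  rw [F.map_comp, Category.assoc, ← μ_natural_assoc]
  dsimp only [Functor.comp_obj, Functor.id_obj]
  rw [h, tensorHom_comp_tensorHom,
    adj.left_triangle_components, adj.left_triangle_components]
  simp

/-- The left adjoint of an adjunction of lax monoidal functors is strong monoidal. -/
lemma isIso_μ_of_adjunction [NatTrans.IsMonoidal adj.unit] [NatTrans.IsMonoidal adj.counit]
    (X Y : U) : IsIso (μ F X Y) := by
  refine ⟨_, μ_comp_map_unit_comp_counit adj X Y, ?_⟩
  have h := NatTrans.IsMonoidal.tensor (τ := adj.unit) X Y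
  simp only [comp_μ, id_μ, Functor.id_obj, Functor.comp_obj,
    Category.id_comp] at h
  -- Naturality of the counit moves `μ F X Y` inside `F`, where monoidality of the unit collapses
  -- everything to the unit at `X ⊗ Y`; a triangle identity remains.
  rw [Category.assoc, ← adj.counit_naturality, ← F.map_comp_assoc, Category.assoc, ← h,
    adj.left_triangle_components]

/-- Transposition turns the product of elements formed in `U` through `μ G` into the product of
their transposes in `V`. With `m` the composition of `C`, this compares composition in `G_* C` with
composition in `C`. -/
lemma μ_comp_homEquiv_symm [NatTrans.IsMonoidal adj.counit] {S T : U} {X Y Z : V}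
    (a : S ⟶ G.obj X) (b : T ⟶ G.obj Y) (m : X ⊗ Y ⟶ Z) :
    μ F S T ≫ (adj.homEquiv _ _).symm ((a ⊗ₘ b) ≫ μ G X Y ≫ G.map m) =
      ((adj.homEquiv _ _).symm a ⊗ₘ (adj.homEquiv _ _).symm b) ≫ m := by
  have h := NatTrans.IsMonoidal.tensor (τ := adj.counit) X Y
  simp only [comp_μ, id_μ, Functor.id_obj, Functor.comp_obj, Category.assoc,
    Category.comp_id] at h
  rw [Adjunction.homEquiv_counit, Adjunction.homEquiv_counit, Adjunction.homEquiv_counit,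
    F.map_comp, F.map_comp, Category.assoc, Category.assoc, adj.counit_naturality,
    ← μ_natural_assoc, reassoc_of% h, tensorHom_comp_tensorHom_assoc]

end MonoidalAdjunction

/-! ### Change of base in terms of generalized elements -/

section ChangeOfBase

variable {V : Type u₁} [Category.{w} V] [MonoidalCategory V] [SymmetricCategory V]
  [MonoidalClosed V] {U : Type u₂} [Category.{w} U] [MonoidalCategory U] [SymmetricCategory U]
  [MonoidalClosed U] {F : U ⥤ V} {G : V ⥤ U} [G.LaxMonoidal] (adj : F ⊣ G)
  {C : Type u₃} [EnrichedCategory V C]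

/-- The representative of `G̃ R` obtained from a representative of the sieve `R`. -/
def MonoInto.changeOfBaseSieve {x : C} (R : MonoInto (Presheaf.representable x : Presheaf V C)) :
    MonoInto (Presheaf.representable (C := TransportEnrichment G C) x :
      Presheaf U (TransportEnrichment G C)) :=
  MonoInto.postcomp (Presheaf.changeOfBaseRepresentable G x) (R.changeOfBase adj)

/-- Factorizations through `G.map (R.hom.app z)` correspond under the adjunction to factorizations
through `R.hom.app z`. The identity composites come from the identification of `G̃ (C(-, x))` with
`(G_* C)(-, x)`. -/
lemma MonoInto.contains_changeOfBaseSieve_iff {x z : C}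
    (R : MonoInto (Presheaf.representable x : Presheaf V C)) {T : U}
    (a : T ⟶ G.obj (z ⟶[V] x)) :
    MonoInto.Contains (C := TransportEnrichment G C) (R.changeOfBaseSieve adj) (x := z) a ↔
      R.Contains (x := z) ((adj.homEquiv _ _).symm a) := by
  constructor
  · rintro ⟨b, hb⟩
    have hb' : b ≫ G.map (R.hom.app z) = a :=
      (congrArg (b ≫ ·) (Category.comp_id (G.map (R.hom.app z)))).symm.trans hb
    refine ⟨(adj.homEquiv _ _).symm b, ?_⟩
    rw [← hb']
    exact (adj.homEquiv_naturality_right_symm _ _).symm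
  · rintro ⟨b, hb⟩
    refine ⟨adj.homEquiv _ _ b, ?_⟩
    have hb' : adj.homEquiv _ _ b ≫ G.map (R.hom.app z) = a := by
      rw [← adj.homEquiv_naturality_right, hb]
      exact (adj.homEquiv _ _).apply_symm_apply a
    exact (congrArg (adj.homEquiv _ _ b ≫ ·) (Category.comp_id (G.map (R.hom.app z)))).trans hb'

/-- After transposition both sides test membership in `R`, for elements with domains `F T ⊗ F g` and
`F (T ⊗ g)`. These elements differ by the isomorphism `μ F T g`. -/
lemma MonoInto.contains_changeOfBaseSieve_pullback_iff [HasPullbacks V] [F.LaxMonoidal]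
    [NatTrans.IsMonoidal adj.unit] [NatTrans.IsMonoidal adj.counit] {x y z : C}
    (R : MonoInto (Presheaf.representable x : Presheaf V C)) {g T : U}
    (f : g ⟶ G.obj (y ⟶[V] x)) (a : T ⟶ G.obj (z ⟶[V] y)) :
    MonoInto.Contains (C := TransportEnrichment G C)
        ((R.pullback ((adj.homEquiv _ _).symm f)).changeOfBaseSieve adj) (x := z) a ↔
      MonoInto.Contains (C := TransportEnrichment G C) (R.changeOfBaseSieve adj) (x := z)
        ((a ⊗ₘ f) ≫ Functor.LaxMonoidal.μ G _ _ ≫ G.map (eComp V z y x)) := by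
  have := isIso_μ_of_adjunction adj T g
  refine (contains_changeOfBaseSieve_iff adj _ a).trans ?_
  refine Iff.trans ?_ (contains_changeOfBaseSieve_iff adj R _).symm
  refine (contains_pullback_iff _ R _).trans ?_
  refine Iff.trans ?_ (contains_iso_comp_iff R _ (Functor.LaxMonoidal.μ F T g))
  exact iff_of_eq (congrArg R.Contains (μ_comp_homEquiv_symm adj a f (eComp V z y x)).symm)

/-! ### Change of base on sieves: maximal sieves, pullbacks, injectivity -/

namespace Sieve

lemma changeOfBase_max (x : C) :
    (Sieve.max x : Sieve V x).changeOfBase adj =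
      Sieve.max (V := U) (C := TransportEnrichment G C) x := by
  refine Quotient.sound (MonoInto.equiv_iff_contains.2 fun z T a => ?_)
  refine (MonoInto.contains_changeOfBaseSieve_iff adj _ a).trans ?_
  exact iff_of_true ⟨_, Category.comp_id _⟩ ⟨a, Category.comp_id _⟩

lemma changeOfBase_pullback [HasPullbacks V] [HasPullbacks U] [F.LaxMonoidal]
    [NatTrans.IsMonoidal adj.unit] [NatTrans.IsMonoidal adj.counit] {x y : C} (R : Sieve V x)
    {g : U} (f : g ⟶ G.obj (y ⟶[V] x)) :
    Sieve.pullback (C := TransportEnrichment G C) (y := y) f (R.changeOfBase adj) =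
      (R.pullback ((adj.homEquiv _ _).symm f)).changeOfBase adj := by
  obtain ⟨R, rfl⟩ := Quotient.exists_rep R
  refine Quotient.sound (MonoInto.equiv_iff_contains.2 fun z T a => ?_)
  exact (MonoInto.contains_pullback_iff (C := TransportEnrichment G C) (z := z) f
    (R.changeOfBaseSieve adj) a).trans
      (MonoInto.contains_changeOfBaseSieve_pullback_iff (C := C) adj R f a).symm

/-- If `G` is conservative, then a monomorphism through which the counit factors is invertible. -/
lemma _root_.CategoryTheory.Adjunction.isIso_of_counit_factor [G.ReflectsIsomorphisms] {X Y : V}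
    (m : X ⟶ Y) [Mono m] (b : F.obj (G.obj Y) ⟶ X) (h : b ≫ m = adj.counit.app Y) : IsIso m := by
  have := adj.rightAdjoint_preservesLimits
  -- The transpose of `b` is a section of `G.map m`, since `b ≫ m` is the counit and the counit
  -- transposes to the identity.
  have : IsSplitEpi (G.map m) := ⟨⟨adj.homEquiv _ _ b, by
    rw [← adj.homEquiv_naturality_right, h, adj.homEquiv_unit, adj.right_triangle_components]⟩⟩
  have := isIso_of_mono_of_isSplitEpi (G.map m)
  exact isIso_of_reflects_iso m G

/-- Elements with domain in the image of `F` suffice to test inclusion. The universal such element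
of `R z` is the counit; once it lands in `S`, it factors through the intersection of `R z` and `S
z`, which conservativity forces to be all of `R z`. -/
lemma contains_of_changeOfBase [HasPullbacks V] [G.ReflectsIsomorphisms] {x z : C}
    {R S : MonoInto (Presheaf.representable x : Presheaf V C)}
    (h : ∀ (T : U) (a : T ⟶ G.obj (z ⟶[V] x)),
      R.Contains (x := z) ((adj.homEquiv _ _).symm a) →
        S.Contains (x := z) ((adj.homEquiv _ _).symm a)) :
    S.Contains (R.hom.app z) := by
  have := S.mono z
  have e : (adj.homEquiv _ _).symm (G.map (R.hom.app z)) = adj.counit.app _ ≫ R.hom.app z := by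
    rw [adj.homEquiv_counit]
    exact adj.counit_naturality _
  obtain ⟨b, hb⟩ := h _ (G.map (R.hom.app z)) ⟨adj.counit.app _, e.symm⟩
  have := adj.isIso_of_counit_factor (Limits.pullback.fst (R.hom.app z) (S.hom.app z))
    (pullback.lift (adj.counit.app _) b (e.symm.trans hb.symm)) (pullback.lift_fst _ _ _)
  exact ⟨inv (Limits.pullback.fst (R.hom.app z) (S.hom.app z)) ≫ pullback.snd _ _, by
    rw [Category.assoc, ← pullback.condition, IsIso.inv_hom_id_assoc]⟩

lemma changeOfBase_injective [HasPullbacks V] [G.ReflectsIsomorphisms] (x : C) :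
    Function.Injective (Sieve.changeOfBase adj : Sieve V x → _) := by
  intro R S h
  obtain ⟨R, rfl⟩ := Quotient.exists_rep R
  obtain ⟨S, rfl⟩ := Quotient.exists_rep S
  have h' : R.changeOfBaseSieve adj ≈ S.changeOfBaseSieve adj := Quotient.exact h
  have key (z : C) (T : U) (a : T ⟶ G.obj (z ⟶[V] x)) :
      R.Contains (x := z) ((adj.homEquiv _ _).symm a) ↔
        S.Contains (x := z) ((adj.homEquiv _ _).symm a) :=
    (MonoInto.contains_changeOfBaseSieve_iff adj R a).symm.trans
      ((MonoInto.equiv_iff_contains.1 h' z T a).trans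
        (MonoInto.contains_changeOfBaseSieve_iff adj S a))
  obtain ⟨σ, hσ⟩ := MonoInto.exists_hom_of_app (R := R) (S := S)
    fun z => contains_of_changeOfBase adj fun T a => (key z T a).1
  obtain ⟨τ, hτ⟩ := MonoInto.exists_hom_of_app (R := S) (S := R)
    fun z => contains_of_changeOfBase adj fun T a => (key z T a).2
  exact Quotient.sound (MonoInto.equiv_of_factor σ τ hσ hτ)

end Sieve

/-! ### Change of base on coverages as a lattice homomorphism -/

namespace Coverage

variable [HasPullbacks V] [HasPullbacks U] [F.LaxMonoidal] [NatTrans.IsMonoidal adj.unit]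
  [NatTrans.IsMonoidal adj.counit] {𝓖U : ObjectProperty U} {𝓖V : ObjectProperty V}
  (h𝓖 : ∀ g : U, 𝓖U g → 𝓖V (F.obj g))

/-- Change of base for coverages. -/
def changeOfBase (J : Coverage 𝓖V C) : Coverage 𝓖U (TransportEnrichment G C) where
  sieves x := Sieve.changeOfBase (C := C) adj '' J.sieves x
  max_mem x := ⟨_, J.max_mem x, Sieve.changeOfBase_max (C := C) adj x⟩
  pullback_mem := by
    rintro x y _ ⟨R, hR, rfl⟩ g hg f
    exact ⟨_, J.pullback_mem x y R hR (F.obj g) (h𝓖 g hg) ((adj.homEquiv _ _).symm f),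
      (Sieve.changeOfBase_pullback (C := C) adj R f).symm⟩

lemma changeOfBase_sieves (J : Coverage 𝓖V C) (x : C) :
    (changeOfBase adj h𝓖 J).sieves x = Sieve.changeOfBase adj '' J.sieves x := rfl

/-- Direct images commute with arbitrary unions, and the added maximal sieve goes to the maximal
sieve. The empty family is therefore included. -/
lemma changeOfBase_sSup (S : Set (Coverage 𝓖V C)) :
    changeOfBase adj h𝓖 (sSup S) = sSup (changeOfBase adj h𝓖 '' S) := by
  refine Coverage.ext (funext fun (x : C) => ?_)
  refine Eq.trans ?_ (sieves_sSup (C := TransportEnrichment G C) _ x).symm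
  rw [changeOfBase_sieves, sieves_sSup, Set.image_insert_eq, Set.image_iUnion₂, Set.biUnion_image,
    Sieve.changeOfBase_max]
  rfl

variable [G.ReflectsIsomorphisms]

lemma changeOfBase_injective :
    Function.Injective (changeOfBase adj h𝓖 : Coverage 𝓖V C → _) := by
  intro J K h
  refine Coverage.ext (funext fun x => (Sieve.changeOfBase_injective adj x).image_injective ?_)
  exact congrFun (congrArg Coverage.sieves h) x

/-- A direct image commutes with intersections when the map is injective and the family non-empty.
The empty meet consists of all sieves, and its image only of those of the form `G̃ R`. -/
lemma changeOfBase_sInf (S : Set (Coverage 𝓖V C)) (hS : S.Nonempty) :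
    changeOfBase adj h𝓖 (sInf S) = sInf (changeOfBase adj h𝓖 '' S) := by
  refine Coverage.ext (funext fun (x : C) => ?_)
  refine Eq.trans ?_ (sieves_sInf (C := TransportEnrichment G C) _ x).symm
  rw [changeOfBase_sieves, sieves_sInf, Set.biInter_image,
    Set.InjOn.image_biInter_eq hS (Sieve.changeOfBase_injective adj x).injOn]
  rfl

/-- Change of base for coverages, as a homomorphism of lattices. -/
def changeOfBaseHom : LatticeHom (Coverage 𝓖V C) (Coverage 𝓖U (TransportEnrichment G C)) where
  toFun := changeOfBase adj h𝓖
  map_sup' J K := by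
    rw [← sSup_pair, changeOfBase_sSup, Set.image_pair, sSup_pair]
  map_inf' J K := by
    rw [← sInf_pair, changeOfBase_sInf _ _ _ (Set.insert_nonempty _ _), Set.image_pair, sInf_pair]

end Coverage

end ChangeOfBase

end EnrichedCoverage

theorem mainTheorem1
    {V : Type u₁} [Category.{w} V] [MonoidalCategory V] [SymmetricCategory V] [MonoidalClosed V]
    [EnrichedCoverage.IsNiceBase V]
    {U : Type u₂} [Category.{w} U] [MonoidalCategory U] [SymmetricCategory U] [MonoidalClosed U]
    [EnrichedCoverage.IsNiceBase U]
    (F : U ⥤ V) [F.LaxMonoidal] (G : V ⥤ U) [G.LaxMonoidal]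
    (adj : F ⊣ G) [NatTrans.IsMonoidal adj.unit] [NatTrans.IsMonoidal adj.counit]
    [G.Faithful] [G.ReflectsIsomorphisms]
    (𝓖U : ObjectProperty U) (h𝓖U : EnrichedCoverage.IsGeneratingFamily 𝓖U)
    (𝓖V : ObjectProperty V) (h𝓖V : ∀ g : U, 𝓖U g → 𝓖V (F.obj g))
    (C : Type u₃) [EnrichedCategory V C] :
    ∃ φ : LatticeHom (EnrichedCoverage.Coverage 𝓖V C) (EnrichedCoverage.Coverage 𝓖U (TransportEnrichment G C)),
      (∀ (J : EnrichedCoverage.Coverage 𝓖V C) (x : C),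
        (φ J).sieves x = EnrichedCoverage.Sieve.changeOfBase adj '' J.sieves x) ∧
      Function.Injective φ ∧
      Monotone φ ∧
      (∀ S : Set (EnrichedCoverage.Coverage 𝓖V C), S.Nonempty → φ (sInf S) = sInf (φ '' S)) ∧
      (∀ S : Set (EnrichedCoverage.Coverage 𝓖V C), φ (sSup S) = sSup (φ '' S)) :=
  ⟨EnrichedCoverage.Coverage.changeOfBaseHom adj h𝓖V, fun _ _ => rfl,
    EnrichedCoverage.Coverage.changeOfBase_injective adj h𝓖V, OrderHomClass.mono _,
    EnrichedCoverage.Coverage.changeOfBase_sInf adj h𝓖V,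
    EnrichedCoverage.Coverage.changeOfBase_sSup adj h𝓖V⟩
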